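/- Let $\mathbb{F}$ be the finite field with $q$ elements, let $1\le \ell\le \ell'$ be integers, put $m=\ell+\ell'$, and let $X=(X_{ij})$ be an $\ell\times\ell'$ matrix whose entries are independent indeterminates over $\mathbb{F}$. Let $\mathcal{F}(\ell,m)\subseteq\mathbb{F}[X]$ be the $\mathbb{F}$-linear span of all minors of $X$ of all orders $0,1,\dots,\ell$, where the only minor of order $0$ is $1$. The affine Grassmann code $C^{\mathbb{A}}(\ell,m)$ is the linear code of length $q^{\ell\ell'}$ that consists of the words $(f(P))_{P}$ for $f\in\mathcal{F}(\ell,m)$, where $P$ runs over all $\ell\times\ell'$ matrices with entries in $\mathbb{F}$. Let $d(\ell,m)$ be its minimum distance, that is, the least Hamming distance between two distinct codewords. Then the number $A_d$ of codewords of $C^{\mathbb{A}}(\ell,m)$ of Hamming weight $d(\ell,m)$ is $$A_d=(q-1)\,q^{\ell^2}\,{\ell' \brack \ell}_q,$$ where, for $1\le k\le n$, $${n\brack k}_q=\frac{(q^n-1)(q^n-q)\cdots(q^n-q^{k-1})}{(q^k-1)(q^k-q)\cdots(q^k-q^{k-1})}$$ is the Gaussian binomial coefficient. -/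

import Mathlib

/-- The set of all minors, of every order `i ≥ 0`, of the generic `ℓ × ℓ'` matrix `X = (X_{ij})`
over `F`. A minor of order `i` is the determinant of the submatrix obtained by choosing `i` rows
and `i` columns (in increasing order); the only minor of order `0` is `1`. The order embeddings
force `i ≤ ℓ` and `i ≤ ℓ'`. -/
def genericMinors (F : Type*) [Field F] (ℓ ℓ' : ℕ) : Set (MvPolynomial (Fin ℓ × Fin ℓ') F) :=
  {M | ∃ (i : ℕ) (r : Fin i ↪o Fin ℓ) (c : Fin i ↪o Fin ℓ'),
    M = ((Matrix.mvPolynomialX (Fin ℓ) (Fin ℓ') F).submatrix r c).det}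

/-- The `F`-linear span, in the polynomial ring `F[X]`, of all minors of the generic matrix. -/
noncomputable def minorSpace (F : Type*) [Field F] (ℓ ℓ' : ℕ) :
    Submodule F (MvPolynomial (Fin ℓ × Fin ℓ') F) :=
  Submodule.span F (genericMinors F ℓ ℓ')

/-- The evaluation map: a polynomial `f ∈ F[X]` is sent to the word `(f(P))_P` of its values at all
`ℓ × ℓ'` matrices `P` over `F`. The coordinates of words are indexed by the matrices themselves. -/
noncomputable def evalMap (F : Type*) [Field F] (ℓ ℓ' : ℕ) :
    MvPolynomial (Fin ℓ × Fin ℓ') F →ₗ[F] (Matrix (Fin ℓ) (Fin ℓ') F → F) :=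
  LinearMap.pi fun P => (MvPolynomial.aeval fun ij : Fin ℓ × Fin ℓ' => P ij.1 ij.2).toLinearMap

/-- The affine Grassmann code: the image of the span of the minors under the evaluation map. -/
noncomputable def affineGrassmannCode (F : Type*) [Field F] (ℓ ℓ' : ℕ) :
    Submodule F (Matrix (Fin ℓ) (Fin ℓ') F → F) :=
  (minorSpace F ℓ ℓ').map (evalMap F ℓ ℓ')

/-- The minimum distance of a code: the least Hamming distance between two distinct codewords. -/
noncomputable def codeMinDist {ι F : Type*} [Fintype ι] [DecidableEq F] (C : Set (ι → F)) : ℕ :=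
  sInf {d | ∃ x ∈ C, ∃ y ∈ C, x ≠ y ∧ hammingDist x y = d}

/-- The Gaussian binomial coefficient
`((q^n - 1)(q^n - q)⋯(q^n - q^(k-1))) / ((q^k - 1)(q^k - q)⋯(q^k - q^(k-1)))`,
as a rational number. -/
def gaussBinom (q n k : ℕ) : ℚ :=
  (∏ i ∈ Finset.range k, ((q : ℚ) ^ n - (q : ℚ) ^ i)) /
    ∏ i ∈ Finset.range k, ((q : ℚ) ^ k - (q : ℚ) ^ i)

/-!
Put `V = F ^ ℓ × F ^ ℓ'` and `W = 0 × F ^ ℓ'`. An alternating form `ω` of degree `ℓ` on `V` has a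
word `formWord`, whose value at `P` is the value of `ω` on the rows of the block matrix `(1 | P)`.
Every minor of `P` is such a value (`affineGrassmannCode_le_range_formWord`), so the weights of
codewords can be studied through the forms.

Call the set of vectors `x` with `ω (x, …) = 0` the radical `K` of `ω`. A nonzero `ω` of degree `k`
has a radical of codimension at least `k`. The weight is bounded from below by induction on `k`: one
fixes the first row `x = e 0 + w` of `(1 | P)`, and the contraction of `ω` with `x`, which is
nonzero exactly when `x ∉ K`, is again a form of the same kind on the span of `W` and the other
unit vectors. If some `e a` lies outside `W + K`, it is put in the first place, and then all
`q ^ n` choices of `w` are good, `n` being the dimension of `W`. Otherwise `W + K = V`, and exactly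
`q ^ n - q ^ (n - r)` choices are good, where `r ≥ k` is the codimension of `K`. In either case the
weight is at least `∏ j = 1, …, k, (q ^ n - q ^ (n - j))`, and equality forces `W + K = V` and
`r = k` (`AlternatingMap.translateWeight_succ_bound`). A form with `r = k` is a multiple of the
determinant pulled back along a linear map `π : V → F ^ k` with kernel `K`, and `W + K = V` says
that `π` is onto already on `W`. Conversely all these forms have the least weight
(`translateWeight_smul_detForm`), and their words, that is, the functions `P ↦ a * det (B + P * A)`
with `A` of full rank, are codewords by multilinearity and Laplace expansion
(`formWord_detForm_mem`).

It remains to count. There are `q - 1` scalars `a` and `q ^ (ℓ ^ 2) * ∏ i < ℓ, (q ^ ℓ' - q ^ i)`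
maps `π`. The lower bound shows that a form is determined by its word, and two pairs `(a, π)` give
the same form exactly when they differ by an element of `GL ℓ F` (`exists_GL_of_smul_detForm_eq`).
So each codeword of least weight comes from `|GL ℓ F|` pairs, and the quotient is the asserted
number.
-/

/-! ### The radical of an alternating form -/

/-- The radical of an alternating form: the vectors that make the form vanish as soon as they
occur as one of its arguments. (It is the whole space for a form of degree `0`.) -/
def AlternatingMap.radical {F V ι : Type*} [Field F] [AddCommGroup V] [Module F V] [DecidableEq ι]
    (ω : V [⋀^ι]→ₗ[F] F) : Submodule F V where
  carrier := {x | ∀ (v : ι → V) (b : ι), ω (Function.update v b x) = 0}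
  add_mem' hx hy v b := by rw [ω.map_update_add, hx, hy, add_zero]
  zero_mem' v b := ω.map_update_zero v b
  smul_mem' c x hx v b := by rw [ω.map_update_smul, hx, smul_zero]

namespace AlternatingMap

variable {F V : Type*} [Field F] [AddCommGroup V] [Module F V]

theorem apply_eq_of_sub_mem_radical {ι : Type*} [DecidableEq ι] [Fintype ι] (ω : V [⋀^ι]→ₗ[F] F)
    {x y : ι → V} (h : ∀ a, x a - y a ∈ ω.radical) : ω x = ω y := by
  have key : ∀ s : Finset ι, ω (s.piecewise x y) = ω y := by
    intro s
    induction s using Finset.induction_on with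
    | empty => simp
    | insert a s ha ih =>
      rw [Finset.piecewise_insert, ← sub_add_cancel (x a) (y a), ω.map_update_add, h a, zero_add,
        ← ih]
      congr 1
      rw [Function.update_eq_self_iff]
      simp [ha]
  simpa using key Finset.univ

theorem mem_radical_iff_curryLeft_eq_zero {k : ℕ} (ω : V [⋀^Fin (k + 1)]→ₗ[F] F) (x : V) :
    x ∈ ω.radical ↔ ω.curryLeft x = 0 := by
  constructor
  · intro h
    ext v
    have := h (Matrix.vecCons 0 v) 0
    simpa [Matrix.vecCons] using this
  · intro h v b
    have h2 := ω.map_perm (Function.update v b x) (Equiv.swap 0 b)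
    have h3 : ω (Function.update v b x ∘ Equiv.swap 0 b) = 0 := by
      have := congrArg (fun g => g (Fin.tail (Function.update v b x ∘ Equiv.swap 0 b))) h
      simp only [curryLeft_apply_apply, zero_apply] at this
      rw [← this]
      congr 1
      conv_lhs => rw [← Fin.cons_self_tail (Function.update v b x ∘ Equiv.swap 0 b)]
      simp [Matrix.vecCons]
    rw [h3] at h2
    rcases Int.units_eq_one_or (Equiv.Perm.sign (Equiv.swap 0 b)) with h4 | h4 <;>
      simpa [h4] using h2.symm

/-- A contraction with `x` has `x` in its radical, so that it does not vanish on any complement of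
the line through `x` unless it is zero. -/
theorem self_mem_radical_curryLeft {k : ℕ} (ω : V [⋀^Fin (k + 1)]→ₗ[F] F) (x : V) :
    x ∈ (ω.curryLeft x).radical := by
  intro v b
  rw [curryLeft_apply_apply]
  refine ω.map_eq_zero_of_eq _ (i := 0) (j := b.succ) ?_ (Fin.succ_ne_zero b).symm
  simp [Matrix.vecCons]

/-- If an alternating form does not vanish on a family, this family is linearly independent even
modulo the radical. -/
theorem linearIndependent_mkQ_radical {ι : Type*} [DecidableEq ι] [Fintype ι]
    (ω : V [⋀^ι]→ₗ[F] F) {v : ι → V} (hv : ω v ≠ 0) :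
    LinearIndependent F (fun a => ω.radical.mkQ (v a)) := by
  rw [Fintype.linearIndependent_iff]
  intro c hc b
  have h1 : ∑ a, c a • v a ∈ ω.radical := by
    rw [← Submodule.ker_mkQ ω.radical, LinearMap.mem_ker, map_sum]
    simpa using hc
  have h2 := h1 v b
  rw [ω.map_update_sum, Finset.sum_eq_single b] at h2
  · rw [ω.map_update_smul, Function.update_eq_self] at h2
    exact (smul_eq_zero.1 h2).resolve_right hv
  · intro a _ hab
    rw [ω.map_update_smul, ω.map_update_self _ hab.symm, smul_zero]
  · simp

theorem card_le_finrank_quotient_radical [FiniteDimensional F V] {ι : Type*} [DecidableEq ι]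
    [Fintype ι] {ω : V [⋀^ι]→ₗ[F] F} (hω : ω ≠ 0) :
    Fintype.card ι ≤ Module.finrank F (V ⧸ ω.radical) := by
  obtain ⟨v, hv⟩ : ∃ v, ω v ≠ 0 := by
    by_contra! h
    exact hω (AlternatingMap.ext h)
  exact (ω.linearIndependent_mkQ_radical hv).fintype_card_le_finrank

/-- A nonzero `k`-form whose radical has the least possible codimension `k` is decomposable: it is
a multiple of the determinant, pulled back along a linear map whose kernel is the radical. -/
theorem exists_eq_smul_det_of_finrank_quotient_radical [FiniteDimensional F V] {k : ℕ}
    {ω : V [⋀^Fin k]→ₗ[F] F} (hω : ω ≠ 0) (hr : Module.finrank F (V ⧸ ω.radical) = k) :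
    ∃ (c : F) (π : V →ₗ[F] (Fin k → F)), c ≠ 0 ∧ Function.Surjective π ∧
      LinearMap.ker π = ω.radical ∧ ∀ x, ω x = c * (Matrix.of fun a => π (x a)).det := by
  obtain ⟨v, hv⟩ : ∃ v, ω v ≠ 0 := by
    by_contra! h
    exact hω (AlternatingMap.ext h)
  let B := basisOfLinearIndependentOfCardEqFinrank' _ (ω.linearIndependent_mkQ_radical hv)
    (by rw [Fintype.card_fin, hr])
  let π : V →ₗ[F] (Fin k → F) := B.equivFun.toLinearMap ∘ₗ ω.radical.mkQ
  let L : (Fin k → F) →ₗ[F] V := Fintype.linearCombination F v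
  have hL : ∀ x, x - L (π x) ∈ ω.radical := by
    intro x
    rw [← Submodule.ker_mkQ ω.radical, LinearMap.mem_ker, map_sub, sub_eq_zero]
    have := B.sum_equivFun (ω.radical.mkQ x)
    conv_lhs => rw [← this]
    simp [L, π, Fintype.linearCombination_apply, B]
  refine ⟨ω v, π, hv, ?_, ?_, fun x => ?_⟩
  · exact B.equivFun.surjective.comp (Submodule.mkQ_surjective _)
  · rw [LinearEquiv.ker_comp, Submodule.ker_mkQ]
  · rw [ω.apply_eq_of_sub_mem_radical (y := fun a => L (π (x a))) fun a => hL (x a)]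
    have h1 := (ω.compLinearMap L).eq_smul_basis_det (Pi.basisFun F (Fin k))
    have h2 := congrArg (fun g => g fun a => π (x a)) h1
    simp only [smul_apply, compLinearMap_apply, smul_eq_mul] at h2
    rw [Pi.basisFun_det_apply] at h2
    have h3 : (fun i => L ((Pi.basisFun F (Fin k)) i)) = v := by
      ext i
      simp [L]
    rw [h3] at h2
    exact h2

end AlternatingMap

/-! ### Lower bound for the weight of an alternating form -/

namespace AlternatingMap

variable {F V W : Type*} [Field F] [AddCommGroup V] [Module F V] [AddCommGroup W] [Module F W]

/-- The number of families `p` in `W` such that the form `ω` does not vanish on the family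
`a ↦ e a + i (p a)`. -/
noncomputable def translateWeight {ι : Type*} (ω : V [⋀^ι]→ₗ[F] F) (e : ι → V) (i : W →ₗ[F] V) :
    ℕ :=
  Nat.card {p : ι → W // ω (fun a => e a + i (p a)) ≠ 0}

theorem translateWeight_comp_perm {ι : Type*} [Fintype ι] [DecidableEq ι] (ω : V [⋀^ι]→ₗ[F] F)
    (e : ι → V) (i : W →ₗ[F] V) (σ : Equiv.Perm ι) :
    ω.translateWeight (e ∘ σ) i = ω.translateWeight e i := by
  refine (Nat.card_congr (Equiv.subtypeEquiv (σ.symm.arrowCongr (Equiv.refl W)) fun p => ?_)).symm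
  have h := ω.map_perm (fun a => e a + i (p a)) σ
  have h2 : (fun a => (e ∘ σ) a + i ((σ.symm.arrowCongr (Equiv.refl W)) p a))
      = (fun a => e a + i (p a)) ∘ σ := by
    ext a
    simp [Equiv.arrowCongr]
  rw [h2, h]
  rcases Int.units_eq_one_or (Equiv.Perm.sign σ) with h4 | h4 <;> simp [h4]

theorem translateWeight_succ [Fintype W] {k : ℕ} (ω : V [⋀^Fin (k + 1)]→ₗ[F] F)
    (e : Fin (k + 1) → V) (i : W →ₗ[F] V) :
    ω.translateWeight e i
      = ∑ w, (ω.curryLeft (e 0 + i w)).translateWeight (Fin.tail e) i := by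
  simp only [translateWeight]
  rw [← Nat.card_sigma]
  refine Nat.card_congr ((Equiv.subtypeEquiv (Fin.consEquiv fun _ => W).symm
    (q := fun x => ω.curryLeft (e 0 + i x.1) (fun a => Fin.tail e a + i (x.2 a)) ≠ 0)
    fun p => ?_).trans ⟨fun x => ⟨x.1.1, x.1.2, x.2⟩, fun x => ⟨⟨x.1, x.2.1⟩, x.2.2⟩,
      fun _ => rfl, fun _ => rfl⟩)
  rw [curryLeft_apply_apply]
  have : (fun a => e a + i (p a)) = Matrix.vecCons (e 0 + i ((Fin.consEquiv fun _ => W).symm p).1)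
      (fun a => Fin.tail e a + i (((Fin.consEquiv fun _ => W).symm p).2 a)) := by
    ext a
    refine Fin.cases ?_ (fun b => ?_) a <;> simp [Fin.consEquiv, Fin.tail]
  rw [this]

/-- A nonzero contraction with `x` is still nonzero when restricted to a subspace that spans the
whole space together with `x`. -/
theorem curryLeft_restrict_ne_zero {k : ℕ} {ω : V [⋀^Fin (k + 1)]→ₗ[F] F} {x : V}
    (hx : ω.curryLeft x ≠ 0) {U : Submodule F V} (hU : U ⊔ Submodule.span F {x} = ⊤) :
    (ω.curryLeft x).compLinearMap U.subtype ≠ 0 := by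
  intro h
  apply hx
  ext v
  have hv : ∀ a, ∃ u : U, v a - u ∈ (ω.curryLeft x).radical := by
    intro a
    have : v a ∈ U ⊔ Submodule.span F {x} := hU ▸ Submodule.mem_top
    obtain ⟨u, hu, y, hy, huy⟩ := Submodule.mem_sup.1 this
    obtain ⟨c, rfl⟩ := Submodule.mem_span_singleton.1 hy
    refine ⟨⟨u, hu⟩, ?_⟩
    rw [← huy, add_sub_cancel_left]
    exact Submodule.smul_mem _ _ (ω.self_mem_radical_curryLeft x)
  choose u hu using hv
  rw [apply_eq_of_sub_mem_radical _ hu]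
  exact congrArg (fun g => g u) h

end AlternatingMap

section Count

variable {F V W : Type*} [Field F] [Fintype F] [AddCommGroup V] [Module F V]
  [AddCommGroup W] [Module F W]

/-- Over a finite field, the number of points `w` for which `e + i w` lies in a subspace `K` that
is supplementary to the range of `i`. -/
theorem card_add_mem_of_range_sup_eq_top [Fintype W] (i : W →ₗ[F] V) (e : V) (K : Submodule F V)
    (h : LinearMap.range i ⊔ K = ⊤) :
    Nat.card {w : W // e + i w ∈ K}
        = Fintype.card F ^ (Module.finrank F W - Module.finrank F (V ⧸ K)) ∧
      Module.finrank F (V ⧸ K) ≤ Module.finrank F W := by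
  have : Module.Finite F W := Module.Finite.of_finite
  have hsurj : LinearMap.range (K.mkQ ∘ₗ i) = ⊤ := by
    rw [LinearMap.range_comp, eq_top_iff, ← Submodule.range_mkQ K,
      LinearMap.range_eq_map K.mkQ, ← h, Submodule.map_sup, Submodule.mkQ_map_self, sup_bot_eq]
  have hker : LinearMap.ker (K.mkQ ∘ₗ i) = K.comap i := by
    rw [LinearMap.ker_comp, Submodule.ker_mkQ]
  have hrank := LinearMap.finrank_range_add_finrank_ker (K.mkQ ∘ₗ i)
  rw [hsurj, hker, finrank_top] at hrank
  obtain ⟨w₀, hw₀⟩ : ∃ w₀, K.mkQ (i w₀) = K.mkQ e := by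
    have : K.mkQ e ∈ LinearMap.range (K.mkQ ∘ₗ i) := hsurj ▸ Submodule.mem_top
    exact this
  rw [← sub_eq_zero, ← map_sub, ← LinearMap.mem_ker, Submodule.ker_mkQ] at hw₀
  refine ⟨?_, by omega⟩
  have hcard : Nat.card {w : W // e + i w ∈ K} = Nat.card (K.comap i) := by
    refine Nat.card_congr (Equiv.subtypeEquiv (Equiv.addRight w₀) fun w => ?_)
    have : i (w + w₀) = (e + i w) + (i w₀ - e) := by rw [map_add]; abel
    simp only [Equiv.coe_addRight, Submodule.mem_comap, this]
    exact (Submodule.add_mem_iff_left _ hw₀).symm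
  rw [hcard, Module.natCard_eq_pow_finrank (K := F), Nat.card_eq_fintype_card]
  congr 1
  omega

end Count

/-- The number of `n × k` matrices of rank `k` over a field with `q` elements, for `k ≤ n`,
written in the form `∏ j = 1, …, k, (q ^ n - q ^ (n - j))`, which suits an induction on `k`
with `n` fixed. -/
def fullRankCount (q n k : ℕ) : ℕ :=
  ∏ j ∈ Finset.range k, (q ^ n - q ^ (n - (j + 1)))

theorem fullRankCount_succ (q n k : ℕ) :
    fullRankCount q n (k + 1) = fullRankCount q n k * (q ^ n - q ^ (n - (k + 1))) :=
  Finset.prod_range_succ _ _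

theorem fullRankCount_pos {q n k : ℕ} (hq : 1 < q) (hk : k ≤ n) : 0 < fullRankCount q n k := by
  refine Finset.prod_pos fun j hj => ?_
  have := Finset.mem_range.1 hj
  exact Nat.sub_pos_of_lt (Nat.pow_lt_pow_right hq (by omega))

namespace AlternatingMap

/-- The induction step for the lower bound on the weight, together with the discussion of
equality. The hypothesis `ih` is the lower bound for forms of degree `k`. -/
theorem translateWeight_succ_bound {F V W : Type*} [Field F] [Fintype F] [AddCommGroup V]
    [Module F V] [FiniteDimensional F V] [AddCommGroup W] [Module F W] [Fintype W] {k : ℕ}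
    (hk : k + 1 ≤ Module.finrank F W) {ω : V [⋀^Fin (k + 1)]→ₗ[F] F} (hω : ω ≠ 0)
    (e : Fin (k + 1) → V) (i : W →ₗ[F] V)
    (he : LinearMap.range i ⊔ Submodule.span F (Set.range e) = ⊤)
    (ih : ∀ (U : Submodule F V) (η : U [⋀^Fin k]→ₗ[F] F), η ≠ 0 →
      ∀ (e' : Fin k → U) (i' : W →ₗ[F] U),
        LinearMap.range i' ⊔ Submodule.span F (Set.range e') = ⊤ →
        fullRankCount (Fintype.card F) (Module.finrank F W) k ≤ η.translateWeight e' i') :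
    fullRankCount (Fintype.card F) (Module.finrank F W) (k + 1) ≤ ω.translateWeight e i ∧
      (ω.translateWeight e i = fullRankCount (Fintype.card F) (Module.finrank F W) (k + 1) →
        LinearMap.range i ⊔ ω.radical = ⊤ ∧ Module.finrank F (V ⧸ ω.radical) = k + 1) := by
  classical
  have hq : 1 < Fintype.card F := Fintype.one_lt_card
  have hcardW : Fintype.card W = Fintype.card F ^ Module.finrank F W :=
    Module.card_eq_pow_finrank
  set q := Fintype.card F
  set n := Module.finrank F W
  have hpos : 0 < fullRankCount q n k := fullRankCount_pos hq (by omega)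
  -- A lower bound for the fibres of `p ↦ p 0`, for any enumeration of the vectors `e a`.
  have fibre : ∀ e : Fin (k + 1) → V,
      LinearMap.range i ⊔ Submodule.span F (Set.range e) = ⊤ → ∀ w, e 0 + i w ∉ ω.radical →
      fullRankCount q n k ≤ (ω.curryLeft (e 0 + i w)).translateWeight (Fin.tail e) i := by
    intro e he w hw
    rw [mem_radical_iff_curryLeft_eq_zero] at hw
    let U := LinearMap.range i ⊔ Submodule.span F (Set.range (Fin.tail e))
    have hUi : ∀ w, i w ∈ U := fun w => Submodule.mem_sup_left ⟨w, rfl⟩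
    have hUe : ∀ a, Fin.tail e a ∈ U := fun a =>
      Submodule.mem_sup_right (Submodule.subset_span ⟨a, rfl⟩)
    have hU : U ⊔ Submodule.span F {e 0 + i w} = ⊤ := by
      rw [eq_top_iff, ← he, sup_le_iff, Submodule.span_le]
      refine ⟨le_sup_of_le_left le_sup_left, ?_⟩
      rintro _ ⟨a, rfl⟩
      refine Fin.cases ?_ (fun b => Submodule.mem_sup_left (hUe b)) a
      have h0 := Submodule.sub_mem _
        (Submodule.mem_sup_right (S := U) (Submodule.mem_span_singleton_self (R := F) (e 0 + i w)))
        (Submodule.mem_sup_left (hUi w))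
      rwa [add_sub_cancel_right] at h0
    refine ih U ((ω.curryLeft (e 0 + i w)).compLinearMap U.subtype)
      (curryLeft_restrict_ne_zero hw hU) (fun a => ⟨_, hUe a⟩) (i.codRestrict U hUi) ?_
    apply Submodule.map_injective_of_injective U.injective_subtype
    rw [Submodule.map_sup, Submodule.map_span, ← LinearMap.range_comp,
      LinearMap.subtype_comp_codRestrict, Submodule.map_top, Submodule.range_subtype, ← Set.range_comp]
    rfl
  have total : ∀ e : Fin (k + 1) → V,
      LinearMap.range i ⊔ Submodule.span F (Set.range e) = ⊤ →
      fullRankCount q n k * Nat.card {w : W // e 0 + i w ∉ ω.radical}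
        ≤ ω.translateWeight e i := by
    intro e he
    rw [translateWeight_succ, mul_comm, Nat.card_eq_fintype_card, Fintype.card_subtype,
      ← smul_eq_mul]
    refine (Finset.card_nsmul_le_sum _ _ _ fun w hw => ?_).trans
      (Finset.sum_le_sum_of_subset (Finset.subset_univ _))
    exact fibre e he w (Finset.mem_filter.1 hw).2
  by_cases hcase : ∀ a, e a ∈ LinearMap.range i ⊔ ω.radical
  · have htop : LinearMap.range i ⊔ ω.radical = ⊤ := by
      rw [eq_top_iff, ← he, sup_le_iff, Submodule.span_le]
      exact ⟨le_sup_left, by rintro _ ⟨a, rfl⟩; exact hcase a⟩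
    have hr := card_le_finrank_quotient_radical hω
    rw [Fintype.card_fin] at hr
    obtain ⟨h1, h2⟩ := card_add_mem_of_range_sup_eq_top i (e 0) _ htop
    have h3 : Nat.card {w : W // e 0 + i w ∉ ω.radical}
        = q ^ n - q ^ (n - Module.finrank F (V ⧸ ω.radical)) := by
      rw [← hcardW, ← h1, Nat.card_eq_fintype_card, Nat.card_eq_fintype_card,
        Fintype.card_subtype_compl]
    have h4 := total e he
    rw [h3] at h4
    have h5 : q ^ (n - Module.finrank F (V ⧸ ω.radical)) ≤ q ^ (n - (k + 1)) :=
      Nat.pow_le_pow_right (by omega) (by omega)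
    refine ⟨le_trans ?_ h4, fun heq => ⟨htop, ?_⟩⟩
    · rw [fullRankCount_succ]
      exact Nat.mul_le_mul_left _ (by omega)
    · rw [heq, fullRankCount_succ] at h4
      have h6 := Nat.le_of_mul_le_mul_left h4 hpos
      have h7 : q ^ (n - (k + 1)) < q ^ n := Nat.pow_lt_pow_right hq (by omega)
      have h8 := (Nat.pow_le_pow_iff_right hq).1
        (show q ^ (n - (k + 1)) ≤ q ^ (n - Module.finrank F (V ⧸ ω.radical)) by omega)
      omega
  · push Not at hcase
    obtain ⟨a, ha⟩ := hcase
    have h1 : ∀ w, e a + i w ∉ ω.radical := by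
      intro w hw
      apply ha
      rw [← add_sub_cancel_right (e a) (i w), sub_eq_neg_add, ← map_neg]
      exact Submodule.add_mem_sup ⟨_, rfl⟩ hw
    have h2 := total (e ∘ Equiv.swap 0 a) (by
      rw [Set.range_comp, (Equiv.swap 0 a).surjective.range_eq, Set.image_univ, he])
    rw [translateWeight_comp_perm] at h2
    simp only [Function.comp_apply, Equiv.swap_apply_left, h1, not_false_eq_true] at h2
    rw [Nat.card_congr (Equiv.subtypeUnivEquiv fun _ => trivial), Nat.card_eq_fintype_card,
      hcardW] at h2
    have h3 : 0 < q ^ (n - (k + 1)) := by positivity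
    have h4 : q ^ (n - (k + 1)) < q ^ n := Nat.pow_lt_pow_right hq (by omega)
    have h5 : fullRankCount q n (k + 1) < fullRankCount q n k * q ^ n := by
      rw [fullRankCount_succ]
      exact Nat.mul_lt_mul_of_pos_left (by omega) hpos
    exact ⟨by omega, fun h => by omega⟩

/-- A nonzero alternating `k`-form has weight at least the number of `n × k` matrices of rank `k`,
where `n` is the dimension of `W`. -/
theorem fullRankCount_le_translateWeight {F W : Type*} [Field F] [Fintype F]
    [AddCommGroup W] [Module F W] [Fintype W] {k : ℕ} (hk : k ≤ Module.finrank F W)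
    {V : Type*} [AddCommGroup V] [Module F V] [FiniteDimensional F V]
    {ω : V [⋀^Fin k]→ₗ[F] F} (hω : ω ≠ 0) (e : Fin k → V) (i : W →ₗ[F] V)
    (he : LinearMap.range i ⊔ Submodule.span F (Set.range e) = ⊤) :
    fullRankCount (Fintype.card F) (Module.finrank F W) k ≤ ω.translateWeight e i := by
  induction k generalizing V with
  | zero =>
    obtain ⟨v, hv⟩ : ∃ v, ω v ≠ 0 := by
      by_contra! h
      exact hω (AlternatingMap.ext h)
    have : Nonempty {p : Fin 0 → W // ω (fun a => e a + i (p a)) ≠ 0} :=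
      ⟨⟨Fin.elim0, by rwa [Subsingleton.elim (fun a => _) v]⟩⟩
    simp [fullRankCount, translateWeight]
  | succ k ih =>
    exact (translateWeight_succ_bound hk hω e i he
      fun U η hη e' i' he' => ih (by omega) hη e' i' he').1

/-- The equality case of `AlternatingMap.fullRankCount_le_translateWeight`: a form of least weight
is decomposable, and the linear map that it factors through is onto already on `W`. -/
theorem exists_eq_smul_det_of_translateWeight_eq {F V W : Type*} [Field F] [Fintype F]
    [AddCommGroup V] [Module F V] [FiniteDimensional F V] [AddCommGroup W] [Module F W] [Fintype W]
    {k : ℕ} (hk : k + 1 ≤ Module.finrank F W) {ω : V [⋀^Fin (k + 1)]→ₗ[F] F} (hω : ω ≠ 0)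
    (e : Fin (k + 1) → V) (i : W →ₗ[F] V)
    (he : LinearMap.range i ⊔ Submodule.span F (Set.range e) = ⊤)
    (h : ω.translateWeight e i
      = fullRankCount (Fintype.card F) (Module.finrank F W) (k + 1)) :
    ∃ (c : F) (π : V →ₗ[F] (Fin (k + 1) → F)), c ≠ 0 ∧ Function.Surjective (π ∘ₗ i) ∧
      ∀ x, ω x = c * (Matrix.of fun a => π (x a)).det := by
  obtain ⟨h1, h2⟩ := (translateWeight_succ_bound hk hω e i he fun U η hη e' i' he' =>
    fullRankCount_le_translateWeight (by omega) hη e' i' he').2 h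
  obtain ⟨c, π, hc, hπ, hker, hdet⟩ := exists_eq_smul_det_of_finrank_quotient_radical hω h2
  refine ⟨c, π, hc, ?_, hdet⟩
  rw [← LinearMap.range_eq_top, LinearMap.range_comp, eq_top_iff, ← LinearMap.range_eq_top.2 hπ,
    ← Submodule.map_top, ← h1, Submodule.map_sup, ← hker]
  exact sup_le le_rfl (Submodule.map_le_iff_le_comap.2 fun x hx => by
    rw [Submodule.mem_comap, LinearMap.mem_ker.1 hx]
    exact Submodule.zero_mem _)

end AlternatingMap

/-! ### Codewords as words of alternating forms -/

section MinorsOfGraph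

variable {F : Type*} [Field F] {ℓ ℓ' : ℕ}

theorem evalMap_genericMinor {n : ℕ} (r : Fin n → Fin ℓ) (c : Fin n → Fin ℓ') :
    evalMap F ℓ ℓ' ((Matrix.mvPolynomialX (Fin ℓ) (Fin ℓ') F).submatrix r c).det
      = fun P => (P.submatrix r c).det := by
  funext P
  simp only [evalMap, LinearMap.pi_apply, AlgHom.toLinearMap_apply, AlgHom.map_det]
  congr 1
  ext a b
  simp

/-- Minors with repeated or unordered rows and columns also give codewords. -/
theorem det_submatrix_mem_affineGrassmannCode {n : ℕ} (r : Fin n → Fin ℓ) (c : Fin n → Fin ℓ') :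
    (fun P : Matrix (Fin ℓ) (Fin ℓ') F => (P.submatrix r c).det) ∈ affineGrassmannCode F ℓ ℓ' := by
  by_cases hr : Function.Injective r
  swap
  · obtain ⟨a, b, hab, hne⟩ : ∃ a b, r a = r b ∧ a ≠ b := by
      simpa [Function.Injective] using hr
    convert Submodule.zero_mem _ using 1
    funext P
    exact Matrix.det_zero_of_row_eq hne (by ext x; simp [hab])
  by_cases hc : Function.Injective c
  swap
  · obtain ⟨a, b, hab, hne⟩ : ∃ a b, c a = c b ∧ a ≠ b := by
      simpa [Function.Injective] using hc
    convert Submodule.zero_mem _ using 1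
    funext P
    exact Matrix.det_zero_of_column_eq hne (by simp [hab])
  have sorted : ∀ {N : ℕ} (f : Fin n → Fin N), Function.Injective f →
      ∃ (g : Fin n ↪o Fin N) (σ : Equiv.Perm (Fin n)), f = g ∘ σ := by
    intro N f hf
    have hmono : StrictMono (f ∘ Tuple.sort f) :=
      (Tuple.monotone_sort f).strictMono_of_injective (hf.comp (Tuple.sort f).injective)
    exact ⟨OrderEmbedding.ofStrictMono _ hmono, (Tuple.sort f)⁻¹, by ext; simp⟩
  obtain ⟨r', σ, rfl⟩ := sorted r hr
  obtain ⟨c', τ, rfl⟩ := sorted c hc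
  have h : (fun P : Matrix (Fin ℓ) (Fin ℓ') F => (P.submatrix (r' ∘ σ) (c' ∘ τ)).det)
      = ((Equiv.Perm.sign σ : ℤ) * (Equiv.Perm.sign τ : ℤ) : F) •
        evalMap F ℓ ℓ' ((Matrix.mvPolynomialX (Fin ℓ) (Fin ℓ') F).submatrix r' c').det := by
    rw [evalMap_genericMinor]
    funext P
    have h1 : P.submatrix (r' ∘ σ) (c' ∘ τ)
        = ((P.submatrix r' c').submatrix id τ).submatrix σ id := rfl
    rw [h1, Matrix.det_permute, Matrix.det_permute', Pi.smul_apply, smul_eq_mul, mul_assoc]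
  rw [h]
  exact Submodule.smul_mem _ _ (Submodule.mem_map_of_mem (Submodule.subset_span ⟨n, r', c', rfl⟩))

/-- The minors of the block matrix `(1 | P)` give codewords: Laplace expansion along the columns of
the unit block reduces them to minors of `P`. -/
theorem det_augmented_mem_affineGrassmannCode {n : ℕ} (r : Fin n → Fin ℓ)
    (s : Fin n → Fin ℓ ⊕ Fin ℓ') :
    (fun P : Matrix (Fin ℓ) (Fin ℓ') F => ((Matrix.fromCols 1 P).submatrix r s).det)
      ∈ affineGrassmannCode F ℓ ℓ' := by
  induction n with
  | zero =>
    convert det_submatrix_mem_affineGrassmannCode (F := F) (ℓ := ℓ) (ℓ' := ℓ') Fin.elim0 Fin.elim0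
    simp
  | succ n ih =>
    by_cases h : ∃ b j, s b = Sum.inl j
    · obtain ⟨b, j, hb⟩ := h
      have : (fun P : Matrix (Fin ℓ) (Fin ℓ') F => ((Matrix.fromCols 1 P).submatrix r s).det)
          = ∑ a : Fin (n + 1), ((-1) ^ (a + b : ℕ) * (1 : Matrix (Fin ℓ) (Fin ℓ) F) (r a) j) •
            fun P : Matrix (Fin ℓ) (Fin ℓ') F =>
              ((Matrix.fromCols 1 P).submatrix (r ∘ a.succAbove) (s ∘ b.succAbove)).det := by
        funext P
        rw [Matrix.det_succ_column _ b, Finset.sum_apply]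
        refine Finset.sum_congr rfl fun a _ => ?_
        rw [Matrix.submatrix_apply, hb, Matrix.fromCols_apply_inl, Matrix.submatrix_submatrix]
        rfl
      rw [this]
      exact Submodule.sum_mem _ fun a _ => Submodule.smul_mem _ _ (ih _ _)
    · have : ∀ b, ∃ c, s b = Sum.inr c := by
        intro b
        rcases hs : s b with j | c
        · exact absurd ⟨b, j, hs⟩ h
        · exact ⟨c, rfl⟩
      choose c hc using this
      obtain rfl : s = Sum.inr ∘ c := funext hc
      exact det_submatrix_mem_affineGrassmannCode r c

/-- The word of an alternating form `ω` of degree `ℓ` on `F ^ ℓ × F ^ ℓ'`: the value at `P` is the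
value of `ω` on the rows of the block matrix `(1 | P)`. -/
def formWord (F : Type*) [Field F] (ℓ ℓ' : ℕ) :
    ((Fin ℓ → F) × (Fin ℓ' → F)) [⋀^Fin ℓ]→ₗ[F] F →ₗ[F] (Matrix (Fin ℓ) (Fin ℓ') F → F) where
  toFun ω P := ω fun a => (Pi.single a 1, P a)
  map_add' _ _ := rfl
  map_smul' _ _ := rfl

theorem formWord_apply (ω : ((Fin ℓ → F) × (Fin ℓ' → F)) [⋀^Fin ℓ]→ₗ[F] F)
    (P : Matrix (Fin ℓ) (Fin ℓ') F) :
    formWord F ℓ ℓ' ω P = ω fun a => (Pi.single a 1, P a) :=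
  rfl

/-- The pullback of the determinant along a linear map to `F ^ k`. -/
def detForm {V : Type*} [AddCommGroup V] [Module F V] {k : ℕ} (π : V →ₗ[F] (Fin k → F)) :
    V [⋀^Fin k]→ₗ[F] F :=
  Matrix.detRowAlternating.compLinearMap π

theorem detForm_apply {V : Type*} [AddCommGroup V] [Module F V] {k : ℕ}
    (π : V →ₗ[F] (Fin k → F)) (x : Fin k → V) :
    detForm π x = (Matrix.of fun a => π (x a)).det :=
  rfl

/-- Every codeword is the word of an alternating form. A minor of `P` with rows `r` and columns `c`
is obtained from the matrix `(1 | P)` by replacing the unit columns with indices `r k` by the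
columns `c k` of `P`. -/
theorem affineGrassmannCode_le_range_formWord :
    affineGrassmannCode F ℓ ℓ' ≤ LinearMap.range (formWord F ℓ ℓ') := by
  classical
  rw [affineGrassmannCode, minorSpace, Submodule.map_span_le]
  rintro _ ⟨n, r, c, rfl⟩
  rw [evalMap_genericMinor]
  let e : Fin n ≃ {j // j ∈ Set.range r} := Equiv.ofInjective r r.injective
  let π : ((Fin ℓ → F) × (Fin ℓ' → F)) →ₗ[F] (Fin ℓ → F) := LinearMap.pi fun j =>
    if h : j ∈ Set.range r then LinearMap.proj (c (e.symm ⟨j, h⟩)) ∘ₗ LinearMap.snd F _ _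
    else LinearMap.proj j ∘ₗ LinearMap.fst F _ _
  have hπr : ∀ x b, π x (r b) = x.2 (c b) := by
    intro x b
    have hb : r b ∈ Set.range r := ⟨b, rfl⟩
    have : e.symm ⟨r b, hb⟩ = b := e.symm_apply_apply b
    simp only [π, LinearMap.pi_apply]
    rw [dif_pos hb, this]
    rfl
  have hπ : ∀ x j, j ∉ Set.range r → π x j = x.1 j := by
    intro x j hj
    simp only [π, LinearMap.pi_apply]
    rw [dif_neg hj]
    rfl
  refine ⟨detForm π, ?_⟩
  funext P
  -- An opaque predicate for the range of `r` keeps the `Fintype` instances of the blocks apart from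
  -- the one on `Set.range r`.
  obtain ⟨p, hp⟩ : ∃ p : Fin ℓ → Prop, ∀ j, j ∈ Set.range r ↔ p j := ⟨_, fun _ => Iff.rfl⟩
  rw [formWord_apply, detForm_apply, Matrix.twoBlockTriangular_det' _ p]
  · have h1 : (Matrix.toSquareBlockProp (Matrix.of fun a => π (Pi.single a 1, P a))
        fun j => ¬ p j) = 1 := by
      ext ⟨a, ha⟩ ⟨b, hb⟩
      rw [← hp] at hb
      simp only [Matrix.toSquareBlockProp_def, Matrix.of_apply, hπ _ _ hb, Matrix.one_apply,
        Pi.single_apply, Subtype.mk.injEq, eq_comm]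
    rw [h1, Matrix.det_one, mul_one]
    refine (Matrix.det_submatrix_equiv_self (e.trans (Equiv.subtypeEquivRight hp)) _).symm.trans ?_
    congr 1
    ext a b
    exact hπr _ b
  · intro a ha b hb
    rw [← hp] at ha hb
    have hab : b ≠ a := fun h => hb (h ▸ ha)
    rw [Matrix.of_apply, hπ _ _ hb]
    exact Pi.single_eq_of_ne hab 1

/-- Words of decomposable forms are codewords. -/
theorem formWord_detForm_mem (π : ((Fin ℓ → F) × (Fin ℓ' → F)) →ₗ[F] (Fin ℓ → F)) :
    formWord F ℓ ℓ' (detForm π) ∈ affineGrassmannCode F ℓ ℓ' := by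
  -- The coefficients of the coordinates of `π`.
  let x : Fin ℓ → Fin ℓ ⊕ Fin ℓ' → F := fun j =>
    Sum.elim (fun b => π (Pi.single b 1, 0) j) (fun c => π (0, Pi.single c 1) j)
  have h : formWord F ℓ ℓ' (detForm π) = ∑ s : Fin ℓ → Fin ℓ ⊕ Fin ℓ', (∏ j, x j (s j)) •
      fun P : Matrix (Fin ℓ) (Fin ℓ') F => ((Matrix.fromCols 1 P).submatrix id s).det := by
    funext P
    rw [formWord_apply, detForm_apply, ← Matrix.det_transpose, Finset.sum_apply]
    have h1 : (Matrix.of fun a => π (Pi.single a 1, P a)).transpose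
        = fun j => ∑ t, x j t • (Matrix.fromCols 1 P).transpose t := by
      ext j a
      have h2 : ((Pi.single a 1, P a) : (Fin ℓ → F) × (Fin ℓ' → F))
          = (Pi.single a 1, 0) + ∑ c, P a c • ((0, Pi.single c 1) : (Fin ℓ → F) × (Fin ℓ' → F)) := by
        ext b
        · simp [Prod.fst_sum]
        · simp [Prod.snd_sum, Finset.sum_apply, Pi.single_apply]
      rw [Matrix.transpose_apply, Matrix.of_apply, h2]
      rw [map_add, map_sum, Pi.add_apply, Finset.sum_apply]
      simp only [map_smul, Pi.smul_apply, smul_eq_mul]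
      simp [x, Matrix.one_apply, mul_comm]
    have h3 := (Matrix.detRowAlternating (n := Fin ℓ) (R := F)).toMultilinearMap.map_sum
      (fun j t => x j t • (Matrix.fromCols 1 P).transpose t)
    rw [h1]
    refine h3.trans (Finset.sum_congr rfl fun s _ => ?_)
    rw [MultilinearMap.map_smul_univ, Pi.smul_apply, ← Matrix.det_transpose]
    rfl
  rw [h]
  exact Submodule.sum_mem _ fun s _ => Submodule.smul_mem _ _
    (det_augmented_mem_affineGrassmannCode _ _)

end MinorsOfGraph

/-! ### Decomposable forms -/

section DecomposableForms

variable {F V W : Type*} [Field F] [AddCommGroup V] [Module F V] [AddCommGroup W] [Module F W]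

/-- Two linear maps onto `F ^ k` pull back the determinant to proportional forms only if they differ
by an element of `GL k F`, whose determinant is the factor. -/
theorem exists_GL_of_smul_detForm_eq {k : ℕ} {π π' : V →ₗ[F] (Fin k → F)}
    (hπ : Function.Surjective π) {c c' : F} (hc : c ≠ 0) (hc' : c' ≠ 0)
    (h : c • detForm π = c' • detForm π') :
    ∃ g : Matrix.GeneralLinearGroup (Fin k) F,
      π' = Matrix.mulVecLin (g : Matrix (Fin k) (Fin k) F) ∘ₗ π ∧
        c' = c * (Matrix.det (g : Matrix (Fin k) (Fin k) F))⁻¹ := by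
  have hx : ∀ x : Fin k → V, c * (Matrix.of fun a => π (x a)).det = c' * (Matrix.of fun a => π' (x a)).det :=
    fun x => congrArg (fun g => g x) h
  choose s hs using fun a : Fin k => hπ (Pi.single a 1)
  have hs1 : (Matrix.of fun a => π (s a)) = 1 := by
    ext a b
    rw [Matrix.of_apply, hs, Matrix.one_apply, Pi.single_apply]
    simp only [eq_comm]
  set M : Matrix (Fin k) (Fin k) F := Matrix.of fun a => π' (s a) with hM
  have hdet : c = c' * M.det := by simpa [hs1] using hx s
  have hdet0 : M.det ≠ 0 := by
    rintro h0
    rw [h0, mul_zero] at hdet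
    exact hc hdet
  have hker : ∀ y, π y = 0 → π' y = 0 := by
    intro y hy
    -- By Cramer's rule the coordinates of `π' y` in the basis `π' (s a)` are determinants
    -- in which one of these vectors is replaced by `π' y`.
    have h1 : M.transpose.cramer (π' y) = 0 := by
      ext a
      have h2 := hx (Function.update s a y)
      have h3 : (Matrix.of fun b => π (Function.update s a y b)).det = 0 :=
        Matrix.det_eq_zero_of_row_eq_zero a fun j => by simp [hy]
      have h4 : (Matrix.of fun b => π' (Function.update s a y b)) = M.updateRow a (π' y) := by
        ext b j
        by_cases hb : b = a
        · subst hb; simp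
        · simp [hb, hM]
      rw [h3, mul_zero, h4] at h2
      rw [Matrix.cramer_transpose_apply, Pi.zero_apply]
      exact (mul_eq_zero.1 h2.symm).resolve_left hc'
    have h5 := M.transpose.mulVec_cramer (π' y)
    rw [h1, Matrix.mulVec_zero, Matrix.det_transpose] at h5
    exact (smul_eq_zero.1 h5.symm).resolve_left hdet0
  refine ⟨Matrix.GeneralLinearGroup.mkOfDetNeZero M.transpose (by rwa [Matrix.det_transpose]),
    ?_, ?_⟩
  · ext x : 1
    have h1 : π (x - ∑ a, π x a • s a) = 0 := by
      rw [map_sub, map_sum, sub_eq_zero]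
      simp only [map_smul, hs]
      ext b
      simp [Finset.sum_apply, Pi.single_apply]
    have h2 := hker _ h1
    rw [map_sub, sub_eq_zero, map_sum] at h2
    rw [h2]
    ext b
    change _ = (M.transpose.mulVec (π x)) b
    simp [Matrix.mulVec, dotProduct, hM, mul_comm]
  · change c' = c * M.transpose.det⁻¹
    rw [hdet, Matrix.det_transpose, mul_inv_cancel_right₀ hdet0]

theorem detForm_mulVecLin_comp {k : ℕ} (g : Matrix (Fin k) (Fin k) F) (π : V →ₗ[F] (Fin k → F)) :
    detForm (g.mulVecLin ∘ₗ π) = g.det • detForm π := by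
  ext x
  rw [AlternatingMap.smul_apply, detForm_apply, detForm_apply, smul_eq_mul,
    ← Matrix.det_transpose g, mul_comm, ← Matrix.det_mul]
  congr 1
  ext a b
  simp [Matrix.mul_apply, Matrix.mulVec, dotProduct, mul_comm]

variable [Fintype F]

theorem fullRankCount_eq_pow_mul_card_GL {n k : ℕ} (hk : k ≤ n) :
    fullRankCount (Fintype.card F) n k = Fintype.card F ^ (k * n - k * k) *
      Nat.card (Matrix.GeneralLinearGroup (Fin k) F) := by
  rw [Matrix.card_GL_field, ← Finset.prod_range (fun i => Fintype.card F ^ k - Fintype.card F ^ i),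
    fullRankCount, ← Finset.prod_range_reflect _ k, ← Nat.mul_sub, pow_mul']
  have hpow : (Fintype.card F ^ (n - k)) ^ k
      = ∏ _j ∈ Finset.range k, Fintype.card F ^ (n - k) := by simp
  rw [hpow, ← Finset.prod_mul_distrib]
  refine Finset.prod_congr rfl fun j hj => ?_
  have := Finset.mem_range.1 hj
  rw [Nat.mul_sub, ← pow_add, ← pow_add]
  congr 2 <;> omega

/-- A decomposable form whose linear map is onto already on `W` has the weight
`fullRankCount`. -/
theorem translateWeight_smul_detForm [Fintype W] {k : ℕ} {π : V →ₗ[F] (Fin k → F)}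
    (e : Fin k → V) (i : W →ₗ[F] V) (hπ : Function.Surjective (π ∘ₗ i)) {c : F} (hc : c ≠ 0) :
    (c • detForm π).translateWeight e i
      = fullRankCount (Fintype.card F) (Module.finrank F W) k := by
  classical
  have : Module.Finite F W := Module.Finite.of_finite
  let T : (Fin k → W) →ₗ[F] (Fin k → Fin k → F) := (π ∘ₗ i).compLeft (Fin k)
  have hT : LinearMap.range T = ⊤ :=
    LinearMap.range_eq_top.2 fun y => ⟨fun a => (hπ (y a)).choose,
      funext fun a => (hπ (y a)).choose_spec⟩
  have hk : k ≤ Module.finrank F W := by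
    simpa using LinearMap.finrank_le_finrank_of_surjective (f := π ∘ₗ i) hπ
  have hval : ∀ p : Fin k → W, (c • detForm π) (fun a => e a + i (p a)) ≠ 0 ↔
      IsUnit (Matrix.of ((fun a => π (e a)) + T p)) := by
    intro p
    rw [Matrix.isUnit_iff_isUnit_det, isUnit_iff_ne_zero, AlternatingMap.smul_apply, smul_eq_mul,
      mul_ne_zero_iff, and_iff_right hc, detForm_apply]
    have : (fun a => π (e a + i (p a))) = (fun a => π (e a)) + T p := by
      funext a
      simp [T]
    rw [this]
  have hfib : ∀ g : Matrix.GeneralLinearGroup (Fin k) F,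
      Nat.card {p : Fin k → W // (fun a => π (e a)) + T p = (g : Matrix (Fin k) (Fin k) F)}
        = Fintype.card F ^ (k * Module.finrank F W - k * k) := by
    intro g
    have h := (card_add_mem_of_range_sup_eq_top T ((fun a => π (e a)) - fun a b => g.1 a b) ⊥
      (by rw [hT, sup_bot_eq])).1
    rw [(Submodule.quotEquivOfEqBot (⊥ : Submodule F (Fin k → Fin k → F)) rfl).finrank_eq] at h
    simp only [Module.finrank_pi_fintype, Module.finrank_self, Finset.sum_const, Finset.card_univ,
      Fintype.card_fin, smul_eq_mul, mul_one] at h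
    rw [← h]
    refine Nat.card_congr (Equiv.subtypeEquivRight fun p => ?_)
    rw [Submodule.mem_bot, sub_add_eq_add_sub, sub_eq_zero]
  rw [AlternatingMap.translateWeight, fullRankCount_eq_pow_mul_card_GL hk]
  have hequiv : {p : Fin k → W // (c • detForm π) (fun a => e a + i (p a)) ≠ 0} ≃
      Σ g : Matrix.GeneralLinearGroup (Fin k) F,
        {p : Fin k → W // (fun a => π (e a)) + T p = (g : Matrix (Fin k) (Fin k) F)} :=
    { toFun := fun p => ⟨((hval p.1).1 p.2).unit, p.1, rfl⟩
      invFun := fun x => ⟨x.2.1, (hval x.2.1).2 (by rw [x.2.2]; exact x.1.isUnit)⟩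
      left_inv := fun _ => rfl
      right_inv := by
        rintro ⟨g, p, hp⟩
        have hu : IsUnit (Matrix.of ((fun a => π (e a)) + T p)) := ⟨g, hp.symm⟩
        obtain rfl : hu.unit = g := Units.ext hp
        rfl }
  rw [Nat.card_congr hequiv, Nat.card_sigma, Finset.sum_congr rfl fun g _ => hfib g,
    Finset.sum_const, Finset.card_univ, smul_eq_mul, mul_comm, Nat.card_eq_fintype_card]

end DecomposableForms

/-! ### Minimum distance and codewords of least weight -/

section MinimumWeight

variable {F : Type*} [Field F] {ℓ ℓ' : ℕ}

theorem range_inr_sup_span_single_eq_top :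
    LinearMap.range (LinearMap.inr F (Fin ℓ → F) (Fin ℓ' → F)) ⊔
      Submodule.span F (Set.range fun a : Fin ℓ =>
        ((Pi.single a 1, 0) : (Fin ℓ → F) × (Fin ℓ' → F))) = ⊤ := by
  rw [eq_top_iff]
  rintro ⟨x, y⟩ -
  have h : ((x, y) : (Fin ℓ → F) × (Fin ℓ' → F)) = LinearMap.inr F (Fin ℓ → F) (Fin ℓ' → F) y
      + ∑ a, x a • (Pi.single a 1, 0) := by
    ext b
    · simp [Prod.fst_sum, Finset.sum_apply, Pi.single_apply]
    · simp [Prod.snd_sum]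
  rw [h]
  exact Submodule.add_mem_sup ⟨y, rfl⟩ (Submodule.sum_mem _ fun a _ =>
    Submodule.smul_mem _ _ (Submodule.subset_span ⟨a, rfl⟩))

variable [Fintype F] [DecidableEq F]

theorem hammingNorm_formWord (ω : ((Fin ℓ → F) × (Fin ℓ' → F)) [⋀^Fin ℓ]→ₗ[F] F) :
    hammingNorm (formWord F ℓ ℓ' ω)
      = ω.translateWeight (fun a => (Pi.single a 1, 0)) (LinearMap.inr F _ (Fin ℓ' → F)) := by
  rw [hammingNorm, AlternatingMap.translateWeight, ← Fintype.card_subtype, ← Nat.card_eq_fintype_card]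
  refine Nat.card_congr (Equiv.subtypeEquivRight fun P => ?_)
  rw [formWord_apply]
  simp

theorem fullRankCount_le_hammingNorm_formWord (h : ℓ ≤ ℓ')
    {ω : ((Fin ℓ → F) × (Fin ℓ' → F)) [⋀^Fin ℓ]→ₗ[F] F} (hω : ω ≠ 0) :
    fullRankCount (Fintype.card F) ℓ' ℓ ≤ hammingNorm (formWord F ℓ ℓ' ω) := by
  rw [hammingNorm_formWord]
  simpa using AlternatingMap.fullRankCount_le_translateWeight (by simpa using h) hω _ _
    range_inr_sup_span_single_eq_top

theorem hammingNorm_formWord_smul_detForm {π : ((Fin ℓ → F) × (Fin ℓ' → F)) →ₗ[F] (Fin ℓ → F)}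
    (hπ : Function.Surjective (π ∘ₗ LinearMap.inr F _ _)) {a : F} (ha : a ≠ 0) :
    hammingNorm (formWord F ℓ ℓ' (a • detForm π)) = fullRankCount (Fintype.card F) ℓ' ℓ := by
  rw [hammingNorm_formWord, translateWeight_smul_detForm _ _ hπ ha]
  simp

/-- The form is determined by its word, since nonzero forms have words of positive weight. -/
theorem formWord_injective (h : ℓ ≤ ℓ') : Function.Injective (formWord F ℓ ℓ') := by
  rw [← LinearMap.ker_eq_bot, LinearMap.ker_eq_bot']
  intro ω hω
  by_contra hne
  have h1 := fullRankCount_le_hammingNorm_formWord h hne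
  rw [hω, hammingNorm_zero] at h1
  have := fullRankCount_pos (Fintype.one_lt_card (α := F)) h
  omega

theorem exists_surjective_comp_inr (F : Type*) [Field F] (h : ℓ ≤ ℓ') :
    ∃ π : ((Fin ℓ → F) × (Fin ℓ' → F)) →ₗ[F] (Fin ℓ → F),
      Function.Surjective (π ∘ₗ LinearMap.inr F _ _) := by
  refine ⟨LinearMap.funLeft F F (Fin.castLE h) ∘ₗ LinearMap.snd F _ _, ?_⟩
  rw [LinearMap.comp_assoc, LinearMap.snd_comp_inr, LinearMap.comp_id]
  exact LinearMap.funLeft_surjective_of_injective _ _ _ (Fin.castLE_injective h)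

theorem codeMinDist_affineGrassmannCode (h : ℓ ≤ ℓ') :
    codeMinDist (affineGrassmannCode F ℓ ℓ' : Set (Matrix (Fin ℓ) (Fin ℓ') F → F))
      = fullRankCount (Fintype.card F) ℓ' ℓ := by
  refine IsLeast.csInf_eq ⟨?_, ?_⟩
  · obtain ⟨π, hπ⟩ := exists_surjective_comp_inr F h
    have h1 := hammingNorm_formWord_smul_detForm hπ one_ne_zero
    rw [one_smul] at h1
    refine ⟨_, formWord_detForm_mem π, 0, Submodule.zero_mem _, ?_, ?_⟩
    · rw [← hammingNorm_ne_zero_iff, h1]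
      exact (fullRankCount_pos Fintype.one_lt_card h).ne'
    · rw [hammingDist_zero_right, h1]
  · rintro _ ⟨x, hx, y, hy, hne, rfl⟩
    obtain ⟨ω, hω⟩ := affineGrassmannCode_le_range_formWord (Submodule.sub_mem _ hy hx)
    rw [hammingDist_eq_hammingNorm, neg_add_eq_sub, ← hω]
    refine fullRankCount_le_hammingNorm_formWord h ?_
    rintro rfl
    rw [map_zero] at hω
    exact hne (sub_eq_zero.1 hω.symm).symm

/-- The codewords of least weight are the nonzero multiples of `P ↦ det (B + P * A)` with `A` of
full rank `ℓ`. Here `A` and `B` are the two components of the linear map `π`. -/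
theorem mem_code_and_hammingNorm_eq_iff (h1 : 1 ≤ ℓ) (h : ℓ ≤ ℓ')
    (w : Matrix (Fin ℓ) (Fin ℓ') F → F) :
    (w ∈ affineGrassmannCode F ℓ ℓ' ∧ hammingNorm w = fullRankCount (Fintype.card F) ℓ' ℓ) ↔
      ∃ (a : Fˣ) (π : ((Fin ℓ → F) × (Fin ℓ' → F)) →ₗ[F] (Fin ℓ → F)),
        Function.Surjective (π ∘ₗ LinearMap.inr F _ _) ∧
          formWord F ℓ ℓ' ((a : F) • detForm π) = w := by
  constructor
  · rintro ⟨hw, hnorm⟩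
    obtain ⟨ω, rfl⟩ := affineGrassmannCode_le_range_formWord hw
    obtain ⟨k, rfl⟩ : ∃ k, ℓ = k + 1 := ⟨ℓ - 1, by omega⟩
    have hω : ω ≠ 0 := by
      rintro rfl
      rw [map_zero, hammingNorm_zero] at hnorm
      exact (fullRankCount_pos Fintype.one_lt_card h).ne hnorm
    rw [hammingNorm_formWord] at hnorm
    obtain ⟨a, π, ha, hπ, hdet⟩ := AlternatingMap.exists_eq_smul_det_of_translateWeight_eq
      (by simpa using h) hω _ _ range_inr_sup_span_single_eq_top (by simpa using hnorm)
    refine ⟨Units.mk0 a ha, π, hπ, ?_⟩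
    congr 1
    ext x
    exact (hdet x).symm
  · rintro ⟨a, π, hπ, rfl⟩
    refine ⟨?_, hammingNorm_formWord_smul_detForm hπ a.ne_zero⟩
    rw [map_smul]
    exact Submodule.smul_mem _ _ (formWord_detForm_mem π)

end MinimumWeight

/-! ### Counting the codewords of least weight -/

section Counting

variable {F : Type*} [Field F] {ℓ ℓ' : ℕ}

theorem surjective_mulVecLin_iff_linearIndependent (A : Matrix (Fin ℓ) (Fin ℓ') F) :
    Function.Surjective A.mulVecLin ↔ LinearIndependent F A.row := by
  rw [linearIndependent_iff_card_eq_finrank_span, Set.finrank, ← Matrix.rank_eq_finrank_span_row,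
    Matrix.rank, ← LinearMap.range_eq_top, Fintype.card_fin]
  constructor
  · intro h
    rw [h, finrank_top, Module.finrank_fin_fun]
  · intro h
    exact Submodule.eq_top_of_finrank_eq (by rw [← h, Module.finrank_fin_fun])

variable [Fintype F]

theorem card_surjective_comp_inr (h : ℓ ≤ ℓ') :
    Nat.card {π : ((Fin ℓ → F) × (Fin ℓ' → F)) →ₗ[F] (Fin ℓ → F) //
        Function.Surjective (π ∘ₗ LinearMap.inr F _ _)}
      = Fintype.card F ^ (ℓ ^ 2) *
        ∏ i : Fin ℓ, (Fintype.card F ^ ℓ' - Fintype.card F ^ (i : ℕ)) := by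
  let E : (((Fin ℓ → F) →ₗ[F] (Fin ℓ → F)) × ((Fin ℓ' → F) →ₗ[F] (Fin ℓ → F))) ≃
      (((Fin ℓ → F) × (Fin ℓ' → F)) →ₗ[F] (Fin ℓ → F)) :=
    (LinearMap.coprodEquiv F).toEquiv
  let E' : Matrix (Fin ℓ) (Fin ℓ) F × Matrix (Fin ℓ) (Fin ℓ') F ≃
      (((Fin ℓ → F) →ₗ[F] (Fin ℓ → F)) × ((Fin ℓ' → F) →ₗ[F] (Fin ℓ → F))) :=
    Matrix.toLin'.toEquiv.prodCongr Matrix.toLin'.toEquiv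
  have hE : ∀ x : Matrix (Fin ℓ) (Fin ℓ) F × Matrix (Fin ℓ) (Fin ℓ') F,
      LinearIndependent F x.2.row ↔
        Function.Surjective ((E'.trans E) x ∘ₗ LinearMap.inr F (Fin ℓ → F) (Fin ℓ' → F)) := by
    intro x
    rw [← surjective_mulVecLin_iff_linearIndependent]
    have : (E'.trans E) x ∘ₗ LinearMap.inr F (Fin ℓ → F) (Fin ℓ' → F) = x.2.mulVecLin := by
      refine LinearMap.ext fun y => ?_
      simp [E, E']
    rw [this]
  rw [← Nat.card_congr (Equiv.subtypeEquiv (E'.trans E) hE)]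
  have e2 : {x : Matrix (Fin ℓ) (Fin ℓ) F × Matrix (Fin ℓ) (Fin ℓ') F //
      LinearIndependent F x.2.row} ≃ Matrix (Fin ℓ) (Fin ℓ) F ×
        {A : Fin ℓ → Fin ℓ' → F // LinearIndependent F A} :=
    { toFun := fun x => (x.1.1, ⟨x.1.2, x.2⟩)
      invFun := fun y => ⟨(y.1, y.2.1), y.2.2⟩
      left_inv := fun _ => rfl
      right_inv := fun _ => rfl }
  rw [Nat.card_congr e2, Nat.card_prod, card_linearIndependent (by simpa using h),
    Module.finrank_fin_fun]
  congr 1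
  rw [Module.natCard_eq_pow_finrank (K := F), Nat.card_eq_fintype_card, Module.finrank_matrix]
  simp [pow_two]

/-- Each minimum weight codeword comes from exactly `|GL ℓ F|` pairs of a unit and a linear map. -/
theorem card_fiber_formWord_smul_detForm (h : ℓ ≤ ℓ')
    (a₀ : Fˣ) {π₀ : ((Fin ℓ → F) × (Fin ℓ' → F)) →ₗ[F] (Fin ℓ → F)}
    (hπ₀ : Function.Surjective (π₀ ∘ₗ LinearMap.inr F _ _)) :
    Nat.card {x : Fˣ × {π : ((Fin ℓ → F) × (Fin ℓ' → F)) →ₗ[F] (Fin ℓ → F) //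
        Function.Surjective (π ∘ₗ LinearMap.inr F _ _)} //
        formWord F ℓ ℓ' ((x.1 : F) • detForm x.2.1) = formWord F ℓ ℓ' ((a₀ : F) • detForm π₀)}
      = Nat.card (Matrix.GeneralLinearGroup (Fin ℓ) F) := by
  classical
  have hπ₀' : Function.Surjective π₀ := by
    rw [LinearMap.coe_comp] at hπ₀
    exact hπ₀.of_comp
  symm
  refine Nat.card_eq_of_bijective (fun g => ⟨(a₀ * (Matrix.GeneralLinearGroup.det g)⁻¹,
    ⟨Matrix.mulVecLin (g : Matrix (Fin ℓ) (Fin ℓ) F) ∘ₗ π₀, ?_⟩), ?_⟩) ⟨?_, ?_⟩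
  · rw [LinearMap.comp_assoc, LinearMap.coe_comp]
    refine Function.Surjective.comp
      (fun y => ⟨(g⁻¹ : Matrix.GeneralLinearGroup (Fin ℓ) F).1.mulVec y, ?_⟩) hπ₀
    rw [Matrix.mulVecLin_apply, Matrix.mulVec_mulVec, ← Units.val_mul, mul_inv_cancel,
      Units.val_one, Matrix.one_mulVec]
  · congr 1
    change ((a₀ * (Matrix.GeneralLinearGroup.det g)⁻¹ : Fˣ) : F) •
      detForm (Matrix.mulVecLin (g : Matrix (Fin ℓ) (Fin ℓ) F) ∘ₗ π₀) = _
    rw [detForm_mulVecLin_comp, ← Matrix.GeneralLinearGroup.val_det_apply, smul_smul,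
      ← Units.val_mul, inv_mul_cancel_right]
  · intro g g' hgg
    have h1 : Matrix.mulVecLin (g : Matrix (Fin ℓ) (Fin ℓ) F) ∘ₗ π₀
        = Matrix.mulVecLin (g' : Matrix (Fin ℓ) (Fin ℓ) F) ∘ₗ π₀ :=
      congrArg (fun x => x.1.2.1) hgg
    rw [LinearMap.cancel_right hπ₀'] at h1
    exact Units.ext (Matrix.toLin'.injective h1)
  · rintro ⟨⟨a, π, hπ⟩, hx⟩
    obtain ⟨g, hg, ha⟩ := exists_GL_of_smul_detForm_eq hπ₀' a₀.ne_zero a.ne_zero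
      (formWord_injective h hx).symm
    refine ⟨g, Subtype.ext (Prod.ext (Units.ext ?_) (Subtype.ext hg.symm))⟩
    rw [ha]
    simp

end Counting

theorem mainTheorem3 (F : Type*) [Field F] [Fintype F] [DecidableEq F] (q : ℕ)
    (hq : Fintype.card F = q) (ℓ ℓ' : ℕ) (hℓ : 1 ≤ ℓ) (hℓℓ' : ℓ ≤ ℓ') :
    (({c : Matrix (Fin ℓ) (Fin ℓ') F → F | c ∈ affineGrassmannCode F ℓ ℓ' ∧
        hammingNorm c = codeMinDist (affineGrassmannCode F ℓ ℓ' : Set (Matrix (Fin ℓ) (Fin ℓ') F → F))}.ncard : ℕ) : ℚ) =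
      ((q : ℚ) - 1) * (q : ℚ) ^ (ℓ ^ 2) * gaussBinom q ℓ' ℓ := by
  subst hq
  rw [codeMinDist_affineGrassmannCode hℓℓ']
  set S := {c : Matrix (Fin ℓ) (Fin ℓ') F → F | c ∈ affineGrassmannCode F ℓ ℓ' ∧
    hammingNorm c = fullRankCount (Fintype.card F) ℓ' ℓ} with hS
  let D := Fˣ × {π : ((Fin ℓ → F) × (Fin ℓ' → F)) →ₗ[F] (Fin ℓ → F) //
    Function.Surjective (π ∘ₗ LinearMap.inr F _ _)}
  let Φ : D → S := fun x => ⟨formWord F ℓ ℓ' ((x.1 : F) • detForm x.2.1),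
    (mem_code_and_hammingNorm_eq_iff hℓ hℓℓ' _).2 ⟨x.1, x.2.1, x.2.2, rfl⟩⟩
  have : Finite (((Fin ℓ → F) × (Fin ℓ' → F)) →ₗ[F] (Fin ℓ → F)) := Module.finite_of_finite F
  have hfib : ∀ s : S, Nat.card {x : D // Φ x = s}
      = Nat.card (Matrix.GeneralLinearGroup (Fin ℓ) F) := by
    rintro ⟨s, hs⟩
    obtain ⟨a, π, hπ, rfl⟩ := (mem_code_and_hammingNorm_eq_iff hℓ hℓℓ' _).1 hs
    rw [← card_fiber_formWord_smul_detForm hℓℓ' a hπ]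
    exact Nat.card_congr (Equiv.subtypeEquivRight fun x => Subtype.ext_iff)
  have hcount : Nat.card D = S.ncard * Nat.card (Matrix.GeneralLinearGroup (Fin ℓ) F) := by
    have := Fintype.ofFinite S
    rw [← Nat.card_congr (Equiv.sigmaFiberEquiv Φ), Nat.card_sigma,
      Finset.sum_congr rfl fun s _ => hfib s, Finset.sum_const, Finset.card_univ, smul_eq_mul,
      ← Nat.card_eq_fintype_card, Nat.card_coe_set_eq]
  have hq : 1 < Fintype.card F := Fintype.one_lt_card
  rw [Nat.card_prod, card_surjective_comp_inr hℓℓ', Nat.card_units, Nat.card_eq_fintype_card,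
    Matrix.card_GL_field] at hcount
  -- The products of the Gaussian binomial coefficient, with the differences taken in `ℕ`.
  have hprod : ∀ n, ℓ ≤ n → ((∏ i : Fin ℓ, (Fintype.card F ^ n - Fintype.card F ^ (i : ℕ)) : ℕ) : ℚ)
      = ∏ i ∈ Finset.range ℓ, ((Fintype.card F : ℚ) ^ n - (Fintype.card F : ℚ) ^ i) := by
    intro n hn
    rw [Finset.prod_range, Nat.cast_prod]
    refine Finset.prod_congr rfl fun i _ => ?_
    rw [Nat.cast_sub (Nat.pow_le_pow_right hq.le (i.2.le.trans hn)), Nat.cast_pow, Nat.cast_pow]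
  have hne : ∏ i ∈ Finset.range ℓ, ((Fintype.card F : ℚ) ^ ℓ - (Fintype.card F : ℚ) ^ i) ≠ 0 := by
    refine Finset.prod_ne_zero_iff.2 fun i hi => sub_ne_zero.2 (ne_of_gt ?_)
    exact pow_lt_pow_right₀ (by exact_mod_cast hq) (Finset.mem_range.1 hi)
  have hcast := congrArg (Nat.cast (R := ℚ)) hcount
  rw [Nat.cast_mul, Nat.cast_mul, Nat.cast_mul, hprod ℓ' hℓℓ', hprod ℓ le_rfl, Nat.cast_pow,
    Nat.cast_sub hq.le, Nat.cast_one] at hcast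
  rw [gaussBinom, ← mul_div_assoc, eq_div_iff hne, ← hcast, mul_assoc]
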